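/- Let $K$ be a compact Hausdorff space and $L\subset K$ a closed nowhere dense subset. Let $X=C_0(K\setminus L)$ be the real Banach space of continuous functions $f:K\setminus L\to\mathbb{R}$ vanishing at infinity, with the supremum norm, and let $\mathrm{Iso}(X)$ be the group (under composition) of surjective linear isometries of $X$. Suppose that $X$ is extremely non-complex, i.e. $\|\mathrm{Id}+T^2\|=1+\|T^2\|$ for every bounded linear operator $T$ on $X$. Then: (a) For every $T\in\mathrm{Iso}(X)$ there is a continuous function $\theta:K\setminus L\to\{-1,1\}$ such that $[T(f)](x)=\theta(x)f(x)$ for all $f\in X$ and $x\in K\setminus L$. (b) Conversely, for every continuous function $\theta:K\setminus L\to\{-1,1\}$, the formula $[T(f)](x)=\theta(x)f(x)$ $(f\in X,\ x\in K\setminus L)$ defines a surjective linear isometry $T$ of $X$. (c) Consequently, $\mathrm{Iso}(X)$ is isomorphic to the Boolean algebra of clopen subsets of $K\setminus L$, in the following sense. The map sending the multiplication by $\theta$ to the clopen set $\{x:\theta(x)=-1\}$ is a well-defined group isomorphism from $\mathrm{Iso}(X)$ onto the clopen subsets of $K\setminus L$ with symmetric difference. Moreover, let $\mathrm{Unc}(X)$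 be the set of unconditional projections, i.e. the bounded linear $P$ with $P^2=P$ and $2P-\mathrm{Id}\in\mathrm{Iso}(X)$; then sending a clopen set $A$ to the multiplication by its indicator function $\chi_A$ is a bijection from the clopen subsets of $K\setminus L$ onto $\mathrm{Unc}(X)$ that takes $\emptyset$ and $K\setminus L$ to $0$ and $\mathrm{Id}$, complement to $P\mapsto \mathrm{Id}-P$, intersection to $(P,Q)\mapsto PQ$, and union to $(P,Q)\mapsto P+Q-PQ$. -/

import Mathlib

open scoped ZeroAtInfty symmDiff

/-- A real Banach space `X` is extremely non-complex if `‖Id + T²‖ = 1 + ‖T²‖` for every bounded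
linear operator `T` on `X`. -/
def IsExtremelyNonComplex (X : Type*) [NormedAddCommGroup X] [NormedSpace ℝ X] : Prop :=
  ∀ T : X →L[ℝ] X,
    ‖ContinuousLinearMap.id ℝ X + T.comp T‖ = 1 + ‖T.comp T‖

/-- The set of unconditional projections on `X`: bounded linear projections `P` such that
`2P - Id` is a surjective linear isometry. -/
def unconditionalProjections (X : Type*) [NormedAddCommGroup X] [NormedSpace ℝ X] :
    Set (X →L[ℝ] X) :=
  {P | P.comp P = P ∧ ∃ T : X ≃ₗᵢ[ℝ] X, ∀ f : X, T f = (2 : ℝ) • P f - f}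

open Filter Topology

/-! ### Surjective isometries of an extremely non-complex space are involutions -/

section Isometry

variable {X : Type*} [NormedAddCommGroup X] [NormedSpace ℝ X]

/-! For a surjective isometry `T`, put `S = (T - T⁻¹)/√2`. Then `Id + S² = (T² + T⁻²)/2` has norm at
most 1, so extreme non-complexity forces `S² = 0`. Hence `(T² - Id)² = 0`, the powers of `T²` grow
linearly unless `T² = Id`, and so `T` is an involution.

On `C₀(Ω)`, disjointness of functions has a metric description, so `T` preserves it. If `T` moved
mass between disjoint regions, a bump `u` would satisfy `u T(u ·) = 0`; the commutator of `T` with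
multiplication by `u` would then be close enough to a complex structure to contradict the hypothesis
(`not_forall_mul_map_mul_eq_zero`). So `T` is local: `T f x` depends only on `f x`, which makes `T`
a multiplication by some `θ`, and `T² = Id` gives `θ² = 1`. Sign functions correspond to clopen
sets, which yields both algebraic descriptions. -/

/-- An isometry `U` with `(U - Id)² = 0` is the identity. -/
theorem LinearIsometry.eq_self_of_apply_apply_eq (U : X →ₗᵢ[ℝ] X)
    (h : ∀ x, U (U x) = (2 : ℝ) • U x - x) (x : X) : U x = x := by
  have key : ∀ n : ℕ, U^[n] x = x + (n : ℝ) • (U x - x) := by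
    intro n
    induction n with
    | zero => simp
    | succ n ih =>
      rw [Function.iterate_succ_apply', ih, map_add, map_smul, map_sub, h x]
      push_cast
      module
  have hnorm : ∀ n : ℕ, ‖U^[n] x‖ = ‖x‖ := by
    intro n
    induction n with
    | zero => simp
    | succ n ih => rw [Function.iterate_succ_apply', U.norm_map, ih]
  by_contra hne
  have hpos : 0 < ‖U x - x‖ := norm_pos_iff.2 (sub_ne_zero.2 hne)
  obtain ⟨n, hn⟩ := exists_nat_gt (2 * ‖x‖ / ‖U x - x‖)
  rw [div_lt_iff₀ hpos] at hn
  have h1 : (n : ℝ) • (U x - x) = U^[n] x - x := by rw [key n]; abel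
  have h2 : (n : ℝ) * ‖U x - x‖ ≤ 2 * ‖x‖ := by
    calc (n : ℝ) * ‖U x - x‖ = ‖(n : ℝ) • (U x - x)‖ := by rw [norm_smul]; simp
      _ = ‖U^[n] x - x‖ := by rw [h1]
      _ ≤ ‖U^[n] x‖ + ‖x‖ := norm_sub_le _ _
      _ = 2 * ‖x‖ := by rw [hnorm]; ring
  linarith

/-- Surjective isometries of an extremely non-complex space are involutions. -/
theorem IsExtremelyNonComplex.isometry_apply_apply (hX : IsExtremelyNonComplex X)
    (T : X ≃ₗᵢ[ℝ] X) (x : X) : T (T x) = x := by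
  let A : X →L[ℝ] X := T.toContinuousLinearEquiv
  let B : X →L[ℝ] X := T.symm.toContinuousLinearEquiv
  -- The factor `1/√2` makes the constant term of `S²` exactly `-Id`, to cancel the identity.
  obtain ⟨c, hc⟩ : ∃ c : ℝ, c * c = 1 / 2 :=
    ⟨√(1 / 2), Real.mul_self_sqrt (by norm_num)⟩
  let S : X →L[ℝ] X := c • (A - B)
  have hS : ∀ y, S (S y) = (1 / 2 : ℝ) • (T (T y) + T.symm (T.symm y)) - y := by
    intro y
    change c • (T (c • (T y - T.symm y)) - T.symm (c • (T y - T.symm y))) = _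
    simp only [map_smul, map_sub, T.apply_symm_apply, T.symm_apply_apply]
    rw [← smul_sub, smul_smul, hc]
    module
  have h1 : ‖ContinuousLinearMap.id ℝ X + S.comp S‖ ≤ 1 := by
    refine ContinuousLinearMap.opNorm_le_bound _ zero_le_one fun y => ?_
    have : (ContinuousLinearMap.id ℝ X + S.comp S) y
        = (1 / 2 : ℝ) • (T (T y) + T.symm (T.symm y)) := by
      change y + S (S y) = _
      rw [hS]; abel
    rw [this, norm_smul]
    have := norm_add_le (T (T y)) (T.symm (T.symm y))
    simp only [LinearIsometryEquiv.norm_map] at this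
    norm_num
    linarith
  have h2 : S.comp S = 0 := by
    rw [hX S] at h1
    exact norm_le_zero_iff.1 (by linarith)
  have h3 : ∀ y, T (T y) + T.symm (T.symm y) = (2 : ℝ) • y := by
    intro y
    have h4 : S (S y) = 0 := congrArg (fun R : X →L[ℝ] X => R y) h2
    rw [hS, sub_eq_zero] at h4
    nth_rewrite 3 [← h4]
    module
  refine LinearIsometry.eq_self_of_apply_apply_eq
    (T.toLinearIsometry.comp T.toLinearIsometry) (fun y => ?_) x
  -- At `T² y` the relation `T² + T⁻² = 2 Id` becomes `T⁴ = 2T² - Id`.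
  have := h3 (T (T y))
  simp only [T.symm_apply_apply] at this
  exact eq_sub_of_add_eq this

end Isometry

/-! ### Multiplication operators attached to clopen sets -/

namespace ZeroAtInftyContinuousMap

variable {Ω : Type*} [TopologicalSpace Ω]

theorem norm_le_iff {f : C₀(Ω, ℝ)} {C : ℝ} (hC : 0 ≤ C) : ‖f‖ ≤ C ↔ ∀ x, |f x| ≤ C := by
  rw [← norm_toBCF_eq_norm, BoundedContinuousFunction.norm_le hC]
  rfl

theorem abs_apply_le_norm (f : C₀(Ω, ℝ)) (x : Ω) : |f x| ≤ ‖f‖ :=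
  (norm_le_iff (norm_nonneg f)).1 le_rfl x

/-- Postcomposition with a continuous function that vanishes at `0`. -/
def postcomp (F : ℝ → ℝ) (hF : Continuous F) (h0 : F 0 = 0) (f : C₀(Ω, ℝ)) : C₀(Ω, ℝ) where
  toFun x := F (f x)
  continuous_toFun := hF.comp f.continuous
  zero_at_infty' := by
    have := (hF.tendsto 0).comp f.zero_at_infty'
    rwa [h0] at this

/-- The product of a bounded continuous function with a function vanishing at infinity. -/
def mulOfBounded (a : Ω → ℝ) (ha : Continuous a) (hb : ∀ x, |a x| ≤ 1) (f : C₀(Ω, ℝ)) :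
    C₀(Ω, ℝ) where
  toFun x := a x * f x
  continuous_toFun := ha.mul f.continuous
  zero_at_infty' := by
    refine squeeze_zero_norm (fun x => ?_) (tendsto_norm_zero.comp f.zero_at_infty')
    rw [norm_mul]
    exact mul_le_of_le_one_left (norm_nonneg _) (hb x)

@[simp]
theorem mulOfBounded_apply (a : Ω → ℝ) (ha : Continuous a) (hb : ∀ x, |a x| ≤ 1)
    (f : C₀(Ω, ℝ)) (x : Ω) : mulOfBounded a ha hb f x = a x * f x := rfl

/-- The projection of `C₀(Ω, ℝ)` given by the indicator function of a clopen set. -/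
noncomputable def clopenProjection (A : TopologicalSpace.Clopens Ω) :
    C₀(Ω, ℝ) →L[ℝ] C₀(Ω, ℝ) :=
  LinearMap.mkContinuous
    { toFun := mulOfBounded ((A : Set Ω).indicator 1)
        (continuous_one.indicator (by simp [A.isClopen.frontier_eq]))
        (fun x => by by_cases h : x ∈ (A : Set Ω) <;> simp [h])
      map_add' := fun f g => by ext x; simp [mul_add]
      map_smul' := fun c f => by ext x; simp; ring } 1 (by
    intro f
    rw [one_mul, norm_le_iff (norm_nonneg f)]
    intro x
    have := abs_apply_le_norm f x
    by_cases h : x ∈ (A : Set Ω) <;> simp [h, this])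

theorem clopenProjection_apply_of_mem {A : TopologicalSpace.Clopens Ω} (f : C₀(Ω, ℝ)) {x : Ω}
    (h : x ∈ A) : clopenProjection A f x = f x := by
  change (A : Set Ω).indicator 1 x * f x = f x
  have h' : x ∈ (A : Set Ω) := h
  simp [h']

theorem clopenProjection_apply_of_notMem {A : TopologicalSpace.Clopens Ω} (f : C₀(Ω, ℝ))
    {x : Ω} (h : x ∉ A) : clopenProjection A f x = 0 := by
  change (A : Set Ω).indicator 1 x * f x = 0
  have h' : x ∉ (A : Set Ω) := h
  simp [h']

/-- The isometry of `C₀(Ω, ℝ)` that changes the sign on a clopen set. -/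
noncomputable def clopenReflection (A : TopologicalSpace.Clopens Ω) :
    C₀(Ω, ℝ) ≃ₗᵢ[ℝ] C₀(Ω, ℝ) where
  toFun f := f - (2 : ℝ) • clopenProjection A f
  invFun f := f - (2 : ℝ) • clopenProjection A f
  map_add' f g := by simp only [map_add]; module
  map_smul' c f := by simp only [map_smul, RingHom.id_apply]; module
  left_inv f := by
    ext x
    by_cases h : x ∈ A
    · simp [clopenProjection_apply_of_mem _ h]; ring
    · simp [clopenProjection_apply_of_notMem _ h]
  right_inv f := by
    ext x
    by_cases h : x ∈ A
    · simp [clopenProjection_apply_of_mem _ h]; ring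
    · simp [clopenProjection_apply_of_notMem _ h]
  norm_map' f := by
    have key : ∀ x, |(f - (2 : ℝ) • clopenProjection A f) x| = |f x| := by
      intro x
      by_cases h : x ∈ A
      · have : f x - 2 * f x = - f x := by ring
        simp [clopenProjection_apply_of_mem _ h, this]
      · simp [clopenProjection_apply_of_notMem _ h]
    change ‖f - (2 : ℝ) • clopenProjection A f‖ = ‖f‖
    apply le_antisymm
    · rw [norm_le_iff (norm_nonneg _)]
      intro x
      rw [key]
      exact abs_apply_le_norm f x
    · rw [norm_le_iff (norm_nonneg _)]
      intro x
      rw [← key]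
      exact abs_apply_le_norm _ x

theorem clopenReflection_apply (A : TopologicalSpace.Clopens Ω) (f : C₀(Ω, ℝ)) :
    clopenReflection A f = f - (2 : ℝ) • clopenProjection A f := rfl

theorem clopenReflection_apply_of_mem {A : TopologicalSpace.Clopens Ω} (f : C₀(Ω, ℝ)) {x : Ω}
    (h : x ∈ A) : clopenReflection A f x = - f x := by
  simp [clopenReflection_apply, clopenProjection_apply_of_mem _ h]; ring

theorem clopenReflection_apply_of_notMem {A : TopologicalSpace.Clopens Ω} (f : C₀(Ω, ℝ))
    {x : Ω} (h : x ∉ A) : clopenReflection A f x = f x := by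
  simp [clopenReflection_apply, clopenProjection_apply_of_notMem _ h]

/-- The clopen set where a continuous sign function is negative. -/
def negClopen (θ : C(Ω, ({-1, 1} : Set ℝ))) : TopologicalSpace.Clopens Ω where
  carrier := {x | (θ x : ℝ) = -1}
  isClopen' := by
    have hc : Continuous fun x => (θ x : ℝ) := continuous_subtype_val.comp θ.continuous
    have h : {x | (θ x : ℝ) = -1} = {x | (θ x : ℝ) < 0} := by
      ext x
      rcases (θ x).2 with h | h <;> rw [Set.mem_ofPred_eq, Set.mem_ofPred_eq, h] <;> norm_num
    exact ⟨isClosed_eq hc continuous_const, h ▸ isOpen_lt hc continuous_const⟩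

theorem clopenReflection_negClopen_apply (θ : C(Ω, ({-1, 1} : Set ℝ))) (f : C₀(Ω, ℝ)) (x : Ω) :
    clopenReflection (negClopen θ) f x = (θ x : ℝ) * f x := by
  by_cases h : x ∈ negClopen θ
  · rw [clopenReflection_apply_of_mem f h, show (θ x : ℝ) = -1 from h]; ring
  · have h1 : (θ x : ℝ) = 1 := (θ x).2.resolve_left h
    rw [clopenReflection_apply_of_notMem f h, h1, one_mul]

/-- At each point `f` or `g` vanishes, so `h + f ± g` takes the value of `h + f` or of `h ± g`. The
converse, `mul_eq_zero_of_norm_le`, makes this a metric test for disjointness. -/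
theorem norm_add_add_le_one_of_mul_eq_zero {f g h : C₀(Ω, ℝ)} (hfg : f * g = 0)
    (h1 : ‖h + f‖ ≤ 1) (h2 : ‖h + g‖ ≤ 1) (h3 : ‖h - g‖ ≤ 1) :
    ‖h + f + g‖ ≤ 1 ∧ ‖h + f - g‖ ≤ 1 := by
  constructor <;> rw [norm_le_iff zero_le_one] at * <;> intro x <;>
    rcases mul_eq_zero.1 (show f x * g x = 0 from DFunLike.congr_fun hfg x) with p | p <;>
    simp only [add_apply, sub_apply, p, add_zero, sub_zero] at h1 h2 h3 ⊢
  · simpa [p] using h2 x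
  · simpa [p] using h1 x
  · simpa [p] using h3 x
  · simpa [p] using h1 x

theorem clopenReflection_symmDiff (A B : TopologicalSpace.Clopens Ω) :
    clopenReflection (A ∆ B) = clopenReflection A * clopenReflection B := by
  ext f x
  change _ = clopenReflection A (clopenReflection B f) x
  have hm : x ∈ A ∆ B ↔ (x ∈ A ∧ x ∉ B) ∨ (x ∈ B ∧ x ∉ A) := Iff.rfl
  by_cases hA : x ∈ A <;> by_cases hB : x ∈ B
  · rw [clopenReflection_apply_of_notMem _ (by tauto), clopenReflection_apply_of_mem _ hA,
      clopenReflection_apply_of_mem _ hB, neg_neg]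
  · rw [clopenReflection_apply_of_mem _ (by tauto), clopenReflection_apply_of_mem _ hA,
      clopenReflection_apply_of_notMem _ hB]
  · rw [clopenReflection_apply_of_mem _ (by tauto), clopenReflection_apply_of_notMem _ hA,
      clopenReflection_apply_of_mem _ hB]
  · rw [clopenReflection_apply_of_notMem _ (by tauto), clopenReflection_apply_of_notMem _ hA,
      clopenReflection_apply_of_notMem _ hB]

theorem clopenProjection_compl (A : TopologicalSpace.Clopens Ω) :
    clopenProjection Aᶜ = ContinuousLinearMap.id ℝ C₀(Ω, ℝ) - clopenProjection A := by
  ext f x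
  change _ = f x - clopenProjection A f x
  have hm : x ∈ Aᶜ ↔ x ∉ A := Iff.rfl
  by_cases hA : x ∈ A
  · rw [clopenProjection_apply_of_notMem _ (by tauto), clopenProjection_apply_of_mem _ hA, sub_self]
  · rw [clopenProjection_apply_of_mem _ (by tauto), clopenProjection_apply_of_notMem _ hA, sub_zero]

theorem clopenProjection_inf (A B : TopologicalSpace.Clopens Ω) :
    clopenProjection (A ⊓ B) = (clopenProjection A).comp (clopenProjection B) := by
  ext f x
  change _ = clopenProjection A (clopenProjection B f) x
  have hm : x ∈ A ⊓ B ↔ x ∈ A ∧ x ∈ B := Iff.rfl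
  by_cases hA : x ∈ A
  · rw [clopenProjection_apply_of_mem _ hA]
    by_cases hB : x ∈ B
    · rw [clopenProjection_apply_of_mem _ (by tauto), clopenProjection_apply_of_mem _ hB]
    · rw [clopenProjection_apply_of_notMem _ (by tauto), clopenProjection_apply_of_notMem _ hB]
  · rw [clopenProjection_apply_of_notMem _ (by tauto), clopenProjection_apply_of_notMem _ hA]

theorem clopenProjection_sup (A B : TopologicalSpace.Clopens Ω) :
    clopenProjection (A ⊔ B) = clopenProjection A + clopenProjection B -
      (clopenProjection A).comp (clopenProjection B) := by
  ext f x
  change _ = clopenProjection A f x + clopenProjection B f x -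
    clopenProjection A (clopenProjection B f) x
  have hm : x ∈ A ⊔ B ↔ x ∈ A ∨ x ∈ B := Iff.rfl
  by_cases hA : x ∈ A
  · rw [clopenProjection_apply_of_mem _ (by tauto), clopenProjection_apply_of_mem _ hA,
      clopenProjection_apply_of_mem _ hA, add_sub_cancel_right]
  · rw [clopenProjection_apply_of_notMem _ hA, clopenProjection_apply_of_notMem _ hA, zero_add,
      sub_zero]
    by_cases hB : x ∈ B
    · rw [clopenProjection_apply_of_mem _ (by tauto), clopenProjection_apply_of_mem _ hB]
    · rw [clopenProjection_apply_of_notMem _ (by tauto), clopenProjection_apply_of_notMem _ hB]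

theorem clopenProjection_bot : clopenProjection (⊥ : TopologicalSpace.Clopens Ω) = 0 := by
  ext f x
  exact clopenProjection_apply_of_notMem f (fun h => h)

theorem clopenProjection_top :
    clopenProjection (⊤ : TopologicalSpace.Clopens Ω) = ContinuousLinearMap.id ℝ C₀(Ω, ℝ) := by
  ext f x
  exact clopenProjection_apply_of_mem f trivial

theorem clopenProjection_mem_unconditionalProjections (A : TopologicalSpace.Clopens Ω) :
    clopenProjection A ∈ unconditionalProjections C₀(Ω, ℝ) := by
  -- `2P - Id` is -1 off `A`, hence the complement.
  refine ⟨by rw [← clopenProjection_inf, inf_idem], clopenReflection Aᶜ, fun f => ?_⟩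
  rw [clopenReflection_apply, clopenProjection_compl]
  change f - (2 : ℝ) • (f - clopenProjection A f) = _
  module

/-! ### Locality of surjective isometries -/

/-- In an extremely non-complex `C₀(Ω, ℝ)`, no multiplication operator by a peaking function `u`
satisfies `uTu = 0` for an isometry `T`. -/
theorem not_forall_mul_map_mul_eq_zero (hX : IsExtremelyNonComplex C₀(Ω, ℝ))
    (T : C₀(Ω, ℝ) ≃ₗᵢ[ℝ] C₀(Ω, ℝ)) {u : C₀(Ω, ℝ)} {x : Ω} (hux : u x = 1)
    (hu : ∀ y, u y ∈ Set.Icc (0 : ℝ) 1) : ¬ ∀ k, u * T (u * k) = 0 := by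
  intro hT
  have hTT := hX.isometry_apply_apply T
  let A : C₀(Ω, ℝ) →L[ℝ] C₀(Ω, ℝ) := T.toContinuousLinearEquiv
  let M : C₀(Ω, ℝ) →L[ℝ] C₀(Ω, ℝ) := ContinuousLinearMap.mul ℝ C₀(Ω, ℝ) u
  -- With `MTM = 0` and `T² = Id`, the commutator satisfies `R² = -M² - TM²T`.
  let R := M.comp A - A.comp M
  have hR : ∀ k, R (R k) = - (u * (u * k)) - T (u * (u * T k)) := by
    intro k
    change u * T (u * T k - T (u * k)) - T (u * (u * T k - T (u * k))) = _
    simp only [map_sub, mul_sub, hT, hTT, map_zero]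
    abel
  have lower : 1 ≤ ‖R.comp R‖ := by
    have h1 : ‖u‖ ≤ 1 := (norm_le_iff zero_le_one).2 fun y => by
      rw [abs_of_nonneg (hu y).1]; exact (hu y).2
    have h2 : R (R u) x = -1 := by
      have h3 : u x * T (u * (u * T u)) x = 0 := DFunLike.congr_fun (hT (u * T u)) x
      rw [hux, one_mul] at h3
      rw [hR, sub_apply, h3, neg_apply, mul_apply, mul_apply, hux]
      norm_num
    calc (1 : ℝ) = |R (R u) x| := by rw [h2]; simp
      _ ≤ ‖(R.comp R) u‖ := abs_apply_le_norm _ x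
      _ ≤ ‖R.comp R‖ * ‖u‖ := ContinuousLinearMap.le_opNorm _ _
      _ ≤ ‖R.comp R‖ := mul_le_of_le_one_right (ContinuousLinearMap.opNorm_nonneg _) h1
  have contract : ∀ k : C₀(Ω, ℝ), ‖k - u * (u * k)‖ ≤ ‖k‖ := by
    intro k
    rw [norm_le_iff (norm_nonneg _)]
    intro y
    have h1 : (k - u * (u * k)) y = (1 - u y * u y) * k y := by
      simp only [sub_apply, mul_apply]; ring
    have h2 := hu y
    have h3 : 0 ≤ 1 - u y * u y := by nlinarith [h2.1, h2.2]
    rw [h1, abs_mul, abs_of_nonneg h3]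
    exact (mul_le_of_le_one_left (abs_nonneg _) (by nlinarith [h2.1])).trans
      (abs_apply_le_norm k y)
  have upper : ‖ContinuousLinearMap.id ℝ C₀(Ω, ℝ) + R.comp R‖ ≤ 1 := by
    refine ContinuousLinearMap.opNorm_le_bound _ zero_le_one fun k => ?_
    rw [one_mul, norm_le_iff (norm_nonneg _)]
    intro y
    have h1 : (ContinuousLinearMap.id ℝ C₀(Ω, ℝ) + R.comp R) k
        = (k - u * (u * k)) - T (u * (u * T k)) := by
      change k + R (R k) = _
      rw [hR]; abel
    rw [h1]
    -- Only one of the two subtracted terms is nonzero at `y`; either way a contraction remains,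
    -- conjugated by `T` in the first case.
    by_cases huy : u y = 0
    · have h2 : ((k - u * (u * k)) - T (u * (u * T k))) y = T (T k - u * (u * T k)) y := by
        rw [map_sub, hTT]
        simp [huy]
      rw [h2]
      refine (abs_apply_le_norm _ y).trans ?_
      rw [T.norm_map]
      exact (contract _).trans (T.norm_map k).le
    · have h2 : u y * T (u * (u * T k)) y = 0 := DFunLike.congr_fun (hT (u * T k)) y
      rw [sub_apply, (mul_eq_zero.1 h2).resolve_left huy, sub_zero]
      exact (abs_apply_le_norm _ y).trans (contract k)
  rw [hX R] at upper
  linarith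

variable [LocallyCompactSpace Ω] [T2Space Ω]

theorem exists_bump {x : Ω} {U : Set Ω} (hU : IsOpen U) (hx : x ∈ U) :
    ∃ u : C₀(Ω, ℝ), u x = 1 ∧ (∀ y ∉ U, u y = 0) ∧ ∀ y, u y ∈ Set.Icc (0 : ℝ) 1 := by
  obtain ⟨u, h1, h2, h3, h4⟩ := exists_continuous_one_zero_of_isCompact
    (isCompact_singleton (x := x)) hU.isClosed_compl
    (Set.disjoint_singleton_left.2 fun h => h hx)
  exact ⟨⟨u, h3.is_zero_at_infty⟩, h1 rfl, fun y hy => h2 hy, h4⟩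

/-- Test with `h` as large at `x` as the constraints allow, namely `1 - max |f x| |g x|`. The
conclusions for `h` and `-h` give `|f x| + |g x| ≤ max |f x| |g x|`, so one of them is zero. -/
theorem mul_eq_zero_of_norm_le {f g : C₀(Ω, ℝ)} (hf : ‖f‖ ≤ 1) (hg : ‖g‖ ≤ 1)
    (H : ∀ h : C₀(Ω, ℝ), ‖h + f‖ ≤ 1 → ‖h - f‖ ≤ 1 → ‖h + g‖ ≤ 1 → ‖h - g‖ ≤ 1 →
      ‖h + f + g‖ ≤ 1 ∧ ‖h + f - g‖ ≤ 1) : f * g = 0 := by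
  ext x
  obtain ⟨u, hu, -, hu1⟩ := exists_bump isOpen_univ (Set.mem_univ x)
  have hf' := (norm_le_iff zero_le_one).1 hf
  have hg' := (norm_le_iff zero_le_one).1 hg
  let a : Ω → ℝ := fun y => 1 - max |f y| |g y|
  have ha0 : ∀ y, 0 ≤ a y := fun y => sub_nonneg.2 (max_le (hf' y) (hg' y))
  have haf : ∀ y, a y ≤ 1 - |f y| := fun y => sub_le_sub_left (le_max_left _ _) _
  have hag : ∀ y, a y ≤ 1 - |g y| := fun y => sub_le_sub_left (le_max_right _ _) _
  have ha : Continuous a :=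
    continuous_const.sub ((f.continuous.abs).max (g.continuous.abs))
  have hb : ∀ y, |a y| ≤ 1 := fun y => by
    rw [abs_of_nonneg (ha0 y)]
    linarith [haf y, abs_nonneg (f y)]
  let h := mulOfBounded a ha hb u
  have hh : ∀ y, |h y| ≤ a y := fun y => by
    rw [mulOfBounded_apply, abs_of_nonneg (mul_nonneg (ha0 y) (hu1 y).1)]
    exact mul_le_of_le_one_right (ha0 y) (hu1 y).2
  have hadd : ∀ (k e : C₀(Ω, ℝ)), (∀ y, |k y| ≤ 1 - |e y|) → ‖k + e‖ ≤ 1 ∧ ‖k - e‖ ≤ 1 := by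
    intro k e hke
    constructor <;> rw [norm_le_iff zero_le_one] <;> intro y
    · have := abs_add_le (k y) (e y)
      rw [add_apply]; linarith [hke y]
    · have := abs_sub (k y) (e y)
      rw [sub_apply]; linarith [hke y]
  have hpf := hadd h f fun y => (hh y).trans (haf y)
  have hpg := hadd h g fun y => (hh y).trans (hag y)
  have hnf := hadd (-h) f fun y => by rw [neg_apply, abs_neg]; exact (hh y).trans (haf y)
  have hng := hadd (-h) g fun y => by rw [neg_apply, abs_neg]; exact (hh y).trans (hag y)
  have H1 := H h hpf.1 hpf.2 hpg.1 hpg.2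
  have H2 := H (-h) hnf.1 hnf.2 hng.1 hng.2
  have hx : h x = a x := by rw [mulOfBounded_apply, hu, mul_one]
  have e1 := abs_le.1 ((norm_le_iff zero_le_one).1 H1.1 x)
  have e2 := abs_le.1 ((norm_le_iff zero_le_one).1 H1.2 x)
  have e3 := abs_le.1 ((norm_le_iff zero_le_one).1 H2.1 x)
  have e4 := abs_le.1 ((norm_le_iff zero_le_one).1 H2.2 x)
  simp only [add_apply, sub_apply, neg_apply, hx] at e1 e2 e3 e4
  have hmin : |f x| + |g x| ≤ max |f x| |g x| := by
    have : a x = 1 - max |f x| |g x| := rfl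
    generalize max |f x| |g x| = m at this ⊢
    rw [this] at e1 e2 e3 e4
    rcases abs_cases (f x) with ⟨p, -⟩ | ⟨p, -⟩ <;> rcases abs_cases (g x) with ⟨q, -⟩ | ⟨q, -⟩ <;>
      rw [p, q] <;> linarith
  rw [mul_apply, zero_apply, mul_eq_zero, ← abs_eq_zero, ← abs_eq_zero (a := g x)]
  rcases max_cases |f x| |g x| with ⟨p, -⟩ | ⟨p, -⟩ <;> rw [p] at hmin
  · right; linarith [abs_nonneg (g x)]
  · left; linarith [abs_nonneg (f x)]

/-- Surjective isometries of `C₀(Ω, ℝ)` preserve disjointness. -/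
theorem isometry_map_mul_eq_zero (T : C₀(Ω, ℝ) ≃ₗᵢ[ℝ] C₀(Ω, ℝ)) {f g : C₀(Ω, ℝ)}
    (hfg : f * g = 0) : T f * T g = 0 := by
  have unit_case : ∀ f g : C₀(Ω, ℝ), ‖f‖ ≤ 1 → ‖g‖ ≤ 1 → f * g = 0 → T f * T g = 0 := by
    intro f g hf hg hfg
    refine mul_eq_zero_of_norm_le (by simpa using hf) (by simpa using hg) fun h h1 h2 h3 h4 => ?_
    obtain ⟨k, rfl⟩ := T.surjective h
    simp only [← map_add, ← map_sub, LinearIsometryEquiv.norm_map] at *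
    exact norm_add_add_le_one_of_mul_eq_zero hfg h1 h3 h4
  have scale : ∀ f : C₀(Ω, ℝ), ∃ c : ℝ, c ≠ 0 ∧ ‖c • f‖ ≤ 1 := by
    intro f
    have hp : 0 < ‖f‖ + 1 := by positivity
    refine ⟨(‖f‖ + 1)⁻¹, inv_ne_zero hp.ne', ?_⟩
    rw [norm_smul, norm_inv, Real.norm_of_nonneg hp.le, inv_mul_le_iff₀ hp]
    linarith
  obtain ⟨c, hc, hcf⟩ := scale f
  obtain ⟨d, hd, hdg⟩ := scale g
  have := unit_case _ _ hcf hdg (by rw [smul_mul_smul_comm, hfg, smul_zero])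
  rw [map_smul, map_smul, smul_mul_smul_comm] at this
  exact (smul_eq_zero.1 this).resolve_left (mul_ne_zero hc hd)

/-- Otherwise take a bump `u` supported where `T f * g ≠ 0`. There `f = 0`, so `u * k` is disjoint
from `f`, hence `T (u * k)` from `T f`, and `u * T (u * k) = 0` for every `k`. -/
theorem isometry_map_mul_eq_zero_right (hX : IsExtremelyNonComplex C₀(Ω, ℝ))
    (T : C₀(Ω, ℝ) ≃ₗᵢ[ℝ] C₀(Ω, ℝ)) {f g : C₀(Ω, ℝ)} (hfg : f * g = 0) : T f * g = 0 := by
  by_contra hne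
  obtain ⟨x, hx⟩ : ∃ x, T f x * g x ≠ 0 := by
    by_contra! h
    exact hne (ext h)
  obtain ⟨u, hux, hu0, hu⟩ := exists_bump (U := {y | T f y * g y ≠ 0})
    (isOpen_ne_fun ((T f).continuous.mul g.continuous) continuous_const) hx
  refine not_forall_mul_map_mul_eq_zero hX T hux hu fun k => ?_
  have hfu : f * (u * k) = 0 := by
    ext y
    by_cases hy : T f y * g y = 0
    · simp [hu0 y (fun h => h hy)]
    · have : f y * g y = 0 := DFunLike.congr_fun hfg y
      simp [(mul_eq_zero.1 this).resolve_right (right_ne_zero_of_mul hy)]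
  ext y
  by_cases hy : T f y * g y = 0
  · simp [hu0 y (fun h => h hy)]
  · have : T f y * T (u * k) y = 0 :=
      DFunLike.congr_fun (isometry_map_mul_eq_zero T hfu) y
    simp [(mul_eq_zero.1 this).resolve_left (left_ne_zero_of_mul hy)]

/-- Clipping `f` at height `ε` gives `k` with `‖T k‖ ≤ ε`, and `f - k` vanishes near `x`, so `T (f -
k) x = 0`. -/
theorem isometry_apply_eq_zero (hX : IsExtremelyNonComplex C₀(Ω, ℝ))
    (T : C₀(Ω, ℝ) ≃ₗᵢ[ℝ] C₀(Ω, ℝ)) {f : C₀(Ω, ℝ)} {x : Ω} (hfx : f x = 0) : T f x = 0 := by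
  rw [← abs_nonpos_iff]
  refine le_of_forall_pos_le_add fun ε hε => ?_
  rw [zero_add]
  let k : C₀(Ω, ℝ) := postcomp (fun t => max (-ε) (min t ε)) (by fun_prop) (by simp [hε.le]) f
  have hk : ∀ y, k y = max (-ε) (min (f y) ε) := fun _ => rfl
  have hk1 : ‖k‖ ≤ ε := by
    rw [norm_le_iff hε.le]
    intro y
    rw [hk, abs_le]
    exact ⟨le_max_left _ _, max_le (by linarith) (min_le_right _ _)⟩
  obtain ⟨u, hux, hu0, -⟩ := exists_bump (U := {y | |f y| < ε})
    (isOpen_lt f.continuous.abs continuous_const) (x := x) (by simpa [hfx] using hε)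
  have hd : (f - k) * u = 0 := by
    ext y
    by_cases hy : |f y| < ε
    · have := abs_lt.1 hy
      simp [hk, min_eq_left this.2.le, max_eq_right this.1.le]
    · simp [hu0 y hy]
  have h0 : T (f - k) x * u x = 0 :=
    DFunLike.congr_fun (isometry_map_mul_eq_zero_right hX T hd) x
  rw [hux, mul_one, map_sub, sub_apply, sub_eq_zero] at h0
  rw [h0]
  exact (abs_apply_le_norm _ x).trans (by rwa [T.norm_map])

/-- Surjective isometries of an extremely non-complex `C₀(Ω, ℝ)` are multiplications by
continuous sign functions. -/
theorem exists_sign_of_isometry (hX : IsExtremelyNonComplex C₀(Ω, ℝ))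
    (T : C₀(Ω, ℝ) ≃ₗᵢ[ℝ] C₀(Ω, ℝ)) :
    ∃ θ : C(Ω, ({-1, 1} : Set ℝ)), ∀ (f : C₀(Ω, ℝ)) (x : Ω), T f x = (θ x : ℝ) * f x := by
  choose e he using fun x : Ω => exists_bump isOpen_univ (Set.mem_univ x)
  have hT : ∀ f x, T f x = T (e x) x * f x := by
    intro f x
    have h := isometry_apply_eq_zero hX T (f := f - f x • e x) (x := x) (by simp [(he x).1])
    rw [map_sub, map_smul, sub_apply, smul_apply, sub_eq_zero, smul_eq_mul] at h
    rw [h, mul_comm]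
  have hsign : ∀ x, T (e x) x ∈ ({-1, 1} : Set ℝ) := by
    intro x
    have h := hT (T (e x)) x
    rw [hX.isometry_apply_apply T, (he x).1] at h
    rcases mul_self_eq_one_iff.1 h.symm with h | h
    · exact Or.inr h
    · exact Or.inl h
  have hcont : Continuous fun x => T (e x) x := by
    rw [continuous_iff_continuousAt]
    intro x
    -- Since `e y` need not vary continuously with `y`, the sign is read off near `x` from the
    -- single function `e x`.
    have h1 : ContinuousAt (fun y => T (e x) y / e x y) x :=
      (T (e x)).continuous.continuousAt.div (e x).continuous.continuousAt
        ((he x).1.trans_ne one_ne_zero)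
    refine h1.congr ?_
    have h2 : ∀ᶠ y in 𝓝 x, e x y ≠ 0 :=
      (e x).continuous.continuousAt.eventually_ne ((he x).1.trans_ne one_ne_zero)
    filter_upwards [h2] with y hy
    rw [hT (e x) y, mul_div_cancel_right₀ _ hy]
  exact ⟨⟨fun x => ⟨T (e x) x, hsign x⟩, hcont.subtype_mk hsign⟩, hT⟩

/-! ### Clopen sets versus isometries and unconditional projections -/

theorem clopenReflection_injective :
    Function.Injective (clopenReflection (Ω := Ω)) := by
  intro A B h
  ext x
  obtain ⟨u, hu, -, -⟩ := exists_bump isOpen_univ (Set.mem_univ x)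
  have hx : clopenReflection A u x = clopenReflection B u x := by rw [h]
  change x ∈ A ↔ x ∈ B
  by_cases hA : x ∈ A <;> by_cases hB : x ∈ B <;>
    simp only [hA, hB, clopenReflection_apply_of_mem, clopenReflection_apply_of_notMem,
      not_false_eq_true, hu] at hx ⊢ <;> norm_num at hx

theorem clopenReflection_surjective (hX : IsExtremelyNonComplex C₀(Ω, ℝ)) :
    Function.Surjective (clopenReflection (Ω := Ω)) := by
  intro T
  obtain ⟨θ, hθ⟩ := exists_sign_of_isometry hX T
  refine ⟨negClopen θ, ?_⟩
  ext f x
  rw [clopenReflection_negClopen_apply, hθ]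

theorem clopenProjection_injective : Function.Injective (clopenProjection (Ω := Ω)) := by
  intro A B h
  apply clopenReflection_injective
  ext1 f
  rw [clopenReflection_apply, clopenReflection_apply, h]

theorem exists_clopenProjection_eq (hX : IsExtremelyNonComplex C₀(Ω, ℝ))
    {P : C₀(Ω, ℝ) →L[ℝ] C₀(Ω, ℝ)} (hP : P ∈ unconditionalProjections C₀(Ω, ℝ)) :
    ∃ A, clopenProjection A = P := by
  obtain ⟨-, T, hT⟩ := hP
  obtain ⟨A, rfl⟩ := clopenReflection_surjective hX T
  refine ⟨Aᶜ, ?_⟩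
  rw [clopenProjection_compl]
  ext1 f
  have h := hT f
  rw [clopenReflection_apply] at h
  change f - clopenProjection A f = P f
  -- If `T = 2P - Id` is the reflection in `A`, then `P = (Id + T)/2` is the projection onto the
  -- complement.
  have h2 : (2 : ℝ) • P f = (2 : ℝ) • (f - clopenProjection A f) := by
    rw [← sub_add_cancel ((2 : ℝ) • P f) f, ← h]
    module
  exact (smul_right_injective _ (two_ne_zero (α := ℝ)) h2).symm

end ZeroAtInftyContinuousMap

open ZeroAtInftyContinuousMap

theorem mainTheorem10 {K : Type*} [TopologicalSpace K] [CompactSpace K] [T2Space K]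
    (L : Set K) (hLclosed : IsClosed L) (hLnd : IsNowhereDense L)
    (hX : IsExtremelyNonComplex C₀((Lᶜ : Set K), ℝ)) :
    -- every surjective isometry is a multiplication by a continuous sign function
    (∀ T : C₀((Lᶜ : Set K), ℝ) ≃ₗᵢ[ℝ] C₀((Lᶜ : Set K), ℝ),
      ∃ θ : C((Lᶜ : Set K), ({-1, 1} : Set ℝ)),
        ∀ (f : C₀((Lᶜ : Set K), ℝ)) (x : (Lᶜ : Set K)), T f x = (θ x : ℝ) * f x) ∧
    -- every multiplication by a continuous sign function is a surjective isometry
    (∀ θ : C((Lᶜ : Set K), ({-1, 1} : Set ℝ)),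
      ∃ T : C₀((Lᶜ : Set K), ℝ) ≃ₗᵢ[ℝ] C₀((Lᶜ : Set K), ℝ),
        ∀ (f : C₀((Lᶜ : Set K), ℝ)) (x : (Lᶜ : Set K)), T f x = (θ x : ℝ) * f x) ∧
    -- the isometry group is isomorphic to the clopen sets with symmetric difference
    (∃ Φ : (C₀((Lᶜ : Set K), ℝ) ≃ₗᵢ[ℝ] C₀((Lᶜ : Set K), ℝ)) ≃
        TopologicalSpace.Clopens (Lᶜ : Set K),
      (∀ S T, Φ (S * T) = Φ S ∆ Φ T) ∧
      (∀ T (f : C₀((Lᶜ : Set K), ℝ)) (x : (Lᶜ : Set K)),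
        (x ∈ Φ T → T f x = - f x) ∧ (x ∉ Φ T → T f x = f x))) ∧
    -- the unconditional projections form a Boolean algebra isomorphic to the clopen sets
    (∃ Ψ : TopologicalSpace.Clopens (Lᶜ : Set K) ≃
        unconditionalProjections C₀((Lᶜ : Set K), ℝ),
      (∀ A (f : C₀((Lᶜ : Set K), ℝ)) (x : (Lᶜ : Set K)),
        (x ∈ A → (Ψ A).1 f x = f x) ∧ (x ∉ A → (Ψ A).1 f x = 0)) ∧
      (Ψ ⊥).1 = 0 ∧ (Ψ ⊤).1 = ContinuousLinearMap.id ℝ C₀((Lᶜ : Set K), ℝ) ∧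
      (∀ A, (Ψ Aᶜ).1 = ContinuousLinearMap.id ℝ C₀((Lᶜ : Set K), ℝ) - (Ψ A).1) ∧
      (∀ A B, (Ψ (A ⊓ B)).1 = (Ψ A).1.comp (Ψ B).1) ∧
      (∀ A B, (Ψ (A ⊔ B)).1 = (Ψ A).1 + (Ψ B).1 - (Ψ A).1.comp (Ψ B).1)) := by
  have : LocallyCompactSpace (Lᶜ : Set K) := hLclosed.isOpen_compl.locallyCompactSpace
  let Φ := Equiv.ofBijective (clopenReflection (Ω := (Lᶜ : Set K)))
    ⟨clopenReflection_injective, clopenReflection_surjective hX⟩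
  let Ψ : TopologicalSpace.Clopens (Lᶜ : Set K) ≃ unconditionalProjections C₀((Lᶜ : Set K), ℝ) :=
    Equiv.ofBijective
      (fun A => ⟨clopenProjection A, clopenProjection_mem_unconditionalProjections A⟩)
      ⟨fun _ _ h => clopenProjection_injective (congrArg Subtype.val h), fun P => by
        obtain ⟨A, hA⟩ := exists_clopenProjection_eq hX P.2
        exact ⟨A, Subtype.ext hA⟩⟩
  refine ⟨exists_sign_of_isometry hX,
    fun θ => ⟨clopenReflection (negClopen θ), clopenReflection_negClopen_apply θ⟩,
    ⟨Φ.symm, fun S T => ?_, fun T f x => ?_⟩,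
    ⟨Ψ, fun A f x => ⟨clopenProjection_apply_of_mem f, clopenProjection_apply_of_notMem f⟩,
      clopenProjection_bot, clopenProjection_top, clopenProjection_compl, clopenProjection_inf,
      clopenProjection_sup⟩⟩
  · rw [Equiv.symm_apply_eq]
    change S * T = clopenReflection (Φ.symm S ∆ Φ.symm T)
    rw [clopenReflection_symmDiff]
    exact congrArg₂ (· * ·) (Φ.apply_symm_apply S).symm (Φ.apply_symm_apply T).symm
  · obtain ⟨A, rfl⟩ := Φ.surjective T
    rw [Φ.symm_apply_apply]
    exact ⟨clopenReflection_apply_of_mem f, clopenReflection_apply_of_notMem f⟩
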